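/- Let $\mathcal X,\mathcal Y\subset\mathbb R^n$ be non-empty, compact, connected sets, each equal to the closure of its interior. Let $\mu\in\mathcal P(\mathcal X)$ and $\nu\in\mathcal P(\mathcal Y)$ be Borel probability measures, let $k>0$, and put $$c(x,y)=\tfrac12|x-y|^2,\qquad m(x,y)=1-\tfrac k2|x-y|^2 \qquad (x\in\mathcal X,\ y\in\mathcal Y),$$ where $|\cdot|$ is the Euclidean norm. Assume $\inf_{x\in\mathcal X,\,y\in\mathcal Y}m(x,y)>0$. Let $\Gamma_m(\mu,\nu)$ be the set of Borel probability measures $\pi$ on $\mathcal X\times\mathcal Y$ whose first marginal is $\mu$ and which satisfy $$\frac{\int_{\mathcal X\times B}m\,d\pi}{\int_{\mathcal X\times\mathcal Y}m\,d\pi}=\nu(B)\qquad\text{for every Borel set }B\subset\mathcal Y .$$ An optimal transport plan is a $\pi^*\in\Gamma_m(\mu,\nu)$ that minimizes $\int c\,d\pi$ over $\pi\in\Gamma_m(\mu,\nu)$. For an optimal transport plan $\pi^*$: - a measurable map $T:\mathcal X\to\mathcal Y$ is called an optimal transport map for $\pi^*$ if $\pi^*=(\mathrm{Id},T)_\sharp\mu$;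 - a measurable map $S:\mathcal Y\to\mathcal X$ is called a dual optimal transport map for $\pi^*$ if $\pi^*=(S,\mathrm{Id})_\sharp\lambda$, where $\lambda(dy)=\frac1Z\,\frac1{m(S(y),y)}\,\nu(dy)$ and $Z$ is the constant that makes $\lambda$ a probability measure. Then an optimal transport plan exists, and the following hold. 1. If $\mu$ is absolutely continuous with respect to Lebesgue measure and $\partial\mathcal X$ has Lebesgue measure $0$, then for every optimal transport plan there exists an optimal transport map $T:\mathcal X\to\mathcal Y$. 2. If $\nu$ is absolutely continuous with respect to Lebesgue measure and $\partial\mathcal Y$ has Lebesgue measure $0$, then for every optimal transport plan there exists a dual optimal transport map $S:\mathcal Y\to\mathcal X$. -/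

import Mathlib

open MeasureTheory

namespace NonConservativeOT

noncomputable section

section General

variable {X Y : Type*} [MeasurableSpace X] [MeasurableSpace Y]

/-- The set `Γ_m(μ, ν)` of non-conservative transport plans: probability measures `π` on `X × Y`
with first marginal `μ` whose mass after transport, `B ↦ ∫_{X × B} m dπ`, is proportional to `ν`.
For a probability measure `ν`, taking `B = Y` shows that membership forces `m` to be integrable
with nonzero integral, so no junk value of the quotient can satisfy the condition. -/
def plans (m : X → Y → ℝ) (μ : Measure X) (ν : Measure Y) : Set (Measure (X × Y)) :=
  {π | IsProbabilityMeasure π ∧ π.map Prod.fst = μ ∧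
    ∀ B : Set Y, MeasurableSet B →
      (∫ p in Set.univ ×ˢ B, m p.1 p.2 ∂π) / (∫ p, m p.1 p.2 ∂π) = ν.real B}

/-- `π` is an optimal transport plan: a minimizer of `∫ c dπ` over `Γ_m(μ, ν)`
(for a bounded measurable cost `c`, so that all the integrals exist). -/
def IsOptimalPlan (c m : X → Y → ℝ) (μ : Measure X) (ν : Measure Y)
    (π : Measure (X × Y)) : Prop :=
  π ∈ plans m μ ν ∧ ∀ π' ∈ plans m μ ν, ∫ p, c p.1 p.2 ∂π ≤ ∫ p, c p.1 p.2 ∂π'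

/-- `T` is a (primal) optimal transport map, representing the optimal plan `π`:
`π = (Id, T)_♯ μ`. -/
def IsOptimalMap (c m : X → Y → ℝ) (μ : Measure X) (ν : Measure Y)
    (π : Measure (X × Y)) (T : X → Y) : Prop :=
  IsOptimalPlan c m μ ν π ∧ Measurable T ∧ π = μ.map (fun x => (x, T x))

/-- The measure with density `1 / m(S(y), y)` with respect to `ν`, before normalization. -/
def dualDensityMeasure (m : X → Y → ℝ) (ν : Measure Y) (S : Y → X) : Measure Y :=
  ν.withDensity (fun y => ENNReal.ofReal (1 / m (S y) y))

/-- The measure `λ(dy) = Z⁻¹ m(S(y), y)⁻¹ ν(dy)`, with `Z` the normalization constant. -/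
def dualSource (m : X → Y → ℝ) (ν : Measure Y) (S : Y → X) : Measure Y :=
  (dualDensityMeasure m ν S Set.univ)⁻¹ • dualDensityMeasure m ν S

/-- `S` is a dual optimal transport map, representing the optimal plan `π`:
`π = (S, Id)_♯ λ` with `λ(dy) = Z⁻¹ m(S(y), y)⁻¹ ν(dy)` a probability measure. -/
def IsDualOptimalMap (c m : X → Y → ℝ) (μ : Measure X) (ν : Measure Y)
    (π : Measure (X × Y)) (S : Y → X) : Prop :=
  IsOptimalPlan c m μ ν π ∧ Measurable S ∧ IsProbabilityMeasure (dualSource m ν S) ∧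
    π = (dualSource m ν S).map (fun y => (S y, y))

end General

/-- The quadratic cost `c(x, y) = |x - y|² / 2` on `ℝⁿ`. -/
def quadraticCost {n : ℕ} (x y : EuclideanSpace ℝ (Fin n)) : ℝ :=
  1 / 2 * ‖x - y‖ ^ 2

/-- The leaky mass-change factor `m(x, y) = 1 - (k / 2) |x - y|²` on `ℝⁿ`. -/
def leakyFactor {n : ℕ} (k : ℝ) (x y : EuclideanSpace ℝ (Fin n)) : ℝ :=
  1 - k / 2 * ‖x - y‖ ^ 2

/-- A non-empty, compact, connected set equal to the closure of its interior. -/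
structure IsCompactDomain {n : ℕ} (A : Set (EuclideanSpace ℝ (Fin n))) : Prop where
  nonempty : A.Nonempty
  isCompact : IsCompact A
  isConnected : IsConnected A
  closure_interior : closure (interior A) = A

end

end NonConservativeOT

open MeasureTheory
open scoped ENNReal

namespace NonConservativeOT

/-! ### Weighted second marginals and the repair of a dominating competitor -/

section Weighted

variable {X Y : Type*} [MeasurableSpace X] [MeasurableSpace Y]

/-! On probability measures `m = 1 - k c` turns minimizing `∫ c` into maximizing the transported
mass `M = ∫ m` (`isOptimalPlan_iff`). A maximizer exists by weak compactness, since the constraint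
can be tested against continuous functions (`exists_isMaxOn_plans`).

The heart is that the support of a maximizer is cyclically monotone for `-log m`. If some cycle
increased the product of the values of `m`, weights on its points could be chosen so that rerouting
a little mass keeps the first marginal and increases the weighted second marginal over every target
box (`exists_rerouting`). The competitor is not a plan, because its weighted marginal only dominates
`M • ν`. It is repaired by thinning it out to exactly `M • ν` and sending the freed source mass to a
further positive multiple of `ν` by a product-type plan (`exists_better_transport`). That
contradicts maximality.

Rockafellar's construction then gives a Lipschitz potential. At an interior point where it is
differentiable, its gradient equals the `x`-gradient of `-log m`, which determines `y` (`twist`). By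
Rademacher's theorem the support is almost surely a graph. For the dual map the same argument runs
on the swapped support, and `dualSource_eq` identifies the second marginal with the normalized
measure in the definition. -/

/-- The second marginal of the measure with density `w` with respect to `π`. -/
noncomputable def weightedSnd (w : X × Y → ℝ≥0∞) (π : Measure (X × Y)) : Measure Y :=
  (π.withDensity w).map Prod.snd

lemma weightedSnd_apply (w : X × Y → ℝ≥0∞) (π : Measure (X × Y)) {B : Set Y}
    (hB : MeasurableSet B) : weightedSnd w π B = ∫⁻ p in Prod.snd ⁻¹' B, w p ∂π := by
  rw [weightedSnd, Measure.map_apply measurable_snd hB,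
    withDensity_apply _ (measurable_snd hB)]

lemma weightedSnd_univ (w : X × Y → ℝ≥0∞) (π : Measure (X × Y)) :
    weightedSnd w π Set.univ = ∫⁻ p, w p ∂π := by
  simp [weightedSnd_apply]

lemma weightedSnd_add (w : X × Y → ℝ≥0∞) (π ρ : Measure (X × Y)) :
    weightedSnd w (π + ρ) = weightedSnd w π + weightedSnd w ρ := by
  ext B hB
  simp [weightedSnd_apply _ _ hB]

lemma weightedSnd_smul (w : X × Y → ℝ≥0∞) (c : ℝ≥0∞) (π : Measure (X × Y)) :
    weightedSnd w (c • π) = c • weightedSnd w π := by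
  ext B hB
  simp [weightedSnd_apply _ _ hB]

lemma weightedSnd_sum {ι : Type*} (s : Finset ι) (w : X × Y → ℝ≥0∞) (π : ι → Measure (X × Y)) :
    weightedSnd w (∑ i ∈ s, π i) = ∑ i ∈ s, weightedSnd w (π i) := by
  classical
  induction s using Finset.induction_on with
  | empty => simp [weightedSnd]
  | insert i s hi ih => rw [Finset.sum_insert hi, weightedSnd_add, ih, Finset.sum_insert hi]

/-- Thinning a plan by a factor depending only on the target thins its weighted marginal by the same
factor. This is how an excess over `M • ν` gets removed exactly. -/
lemma weightedSnd_withDensity_snd {w : X × Y → ℝ≥0∞} (hw : Measurable w) {f : Y → ℝ≥0∞}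
    (hf : Measurable f) (π : Measure (X × Y)) :
    weightedSnd w (π.withDensity (fun p => f p.2)) = (weightedSnd w π).withDensity f := by
  have hf' : Measurable (fun p : X × Y => f p.2) := hf.comp measurable_snd
  ext B hB
  rw [weightedSnd_apply _ _ hB, withDensity_apply _ hB, weightedSnd,
    setLIntegral_map hB hf measurable_snd,
    setLIntegral_withDensity_eq_setLIntegral_mul _ hf' hw (measurable_snd hB),
    setLIntegral_withDensity_eq_setLIntegral_mul _ hw hf' (measurable_snd hB)]
  simp [mul_comm]

/-- Every nonzero finite measure can be transported to a positive multiple of `ν`. -/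
lemma exists_transport {w : X × Y → ℝ≥0∞} (hw : Measurable w) {d : ℝ≥0∞} (hd : d ≠ 0)
    (hdw : ∀ p, d ≤ w p) (hw1 : ∀ p, w p ≤ 1) (ν : Measure Y) [IsProbabilityMeasure ν]
    (θ : Measure X) [IsFiniteMeasure θ] (hθ : θ ≠ 0) :
    ∃ τ : Measure (X × Y), τ.map Prod.fst = θ ∧ ∃ t : ℝ≥0∞, t ≠ 0 ∧ weightedSnd w τ = t • ν := by
  set h : Y → ℝ≥0∞ := fun y => ∫⁻ x, w (x, y) ∂θ with hh
  have hmeas : Measurable h := hw.lintegral_prod_left'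
  have hθ0 : θ Set.univ ≠ 0 := by simpa using hθ
  have hlow : ∀ y, d * θ Set.univ ≤ h y := fun y => by
    rw [← lintegral_const]; exact lintegral_mono fun x => hdw _
  have hup : ∀ y, h y ≤ θ Set.univ := fun y => by
    rw [← one_mul (θ Set.univ), ← lintegral_const]; exact lintegral_mono fun x => hw1 _
  have hpos : ∀ y, h y ≠ 0 := fun y => ((mul_ne_zero hd hθ0).bot_lt.trans_le (hlow y)).ne'
  have hfin : ∀ y, h y ≠ ∞ := fun y => ne_top_of_le_ne_top (measure_ne_top _ _) (hup y)
  -- In `θ.prod κ` the point `y` receives weighted mass `h y` times `κ`, so the density `1 / h`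
  -- makes the result exactly `ν`. Normalizing `κ` restores the first marginal `θ`.
  set κ : Measure Y := ν.withDensity (fun y => (h y)⁻¹) with hκ
  have hκu : κ Set.univ = ∫⁻ y, (h y)⁻¹ ∂ν := by simp [hκ]
  have hZ0 : κ Set.univ ≠ 0 := by
    rw [hκu]
    refine ((ENNReal.inv_ne_zero.2 (measure_ne_top θ Set.univ)).bot_lt.trans_le ?_).ne'
    calc (θ Set.univ)⁻¹ = ∫⁻ _, (θ Set.univ)⁻¹ ∂ν := by simp
      _ ≤ _ := lintegral_mono fun y => ENNReal.inv_le_inv.2 (hup y)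
  have hZt : κ Set.univ ≠ ∞ := by
    rw [hκu]
    refine ne_top_of_le_ne_top (ENNReal.inv_ne_top.2 (mul_ne_zero hd hθ0)) ?_
    calc _ ≤ ∫⁻ _, (d * θ Set.univ)⁻¹ ∂ν :=
          lintegral_mono fun y => ENNReal.inv_le_inv.2 (hlow y)
      _ = _ := by simp
  have : IsFiniteMeasure κ := ⟨hZt.lt_top⟩
  refine ⟨(κ Set.univ)⁻¹ • θ.prod κ, ?_, (κ Set.univ)⁻¹, ENNReal.inv_ne_zero.2 hZt, ?_⟩
  · rw [Measure.map_smul, Measure.map_fst_prod, smul_smul, ENNReal.inv_mul_cancel hZ0 hZt,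
      one_smul]
  · rw [weightedSnd_smul]
    congr 1
    ext B hB
    have hBe : (Prod.snd ⁻¹' B : Set (X × Y)) = Set.univ ×ˢ B := by ext; simp
    rw [weightedSnd_apply _ _ hB, hBe, ← Measure.prod_restrict, Measure.restrict_univ,
      lintegral_prod_symm' _ hw]
    change ∫⁻ y in B, h y ∂κ = ν B
    rw [hκ, setLIntegral_withDensity_eq_setLIntegral_mul _
      (show Measurable fun y => (h y)⁻¹ from hmeas.inv) hmeas hB]
    simp [ENNReal.inv_mul_cancel (hpos _) (hfin _)]

/-- A competitor whose weighted second marginal dominates `M • ν` with strictly larger mass can be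
turned into a transport to a multiple of `ν` larger than `M`. -/
lemma exists_better_transport {w : X × Y → ℝ≥0∞} (hw : Measurable w) {d : ℝ≥0∞} (hd : d ≠ 0)
    (hdw : ∀ p, d ≤ w p) (hw1 : ∀ p, w p ≤ 1) (ν : Measure Y) [IsProbabilityMeasure ν]
    (π : Measure (X × Y)) [IsFiniteMeasure π] {M : ℝ≥0∞} (hle : M • ν ≤ weightedSnd w π)
    (hlt : M < weightedSnd w π Set.univ) :
    ∃ ρ : Measure (X × Y), ρ.map Prod.fst = π.map Prod.fst ∧
      ∃ M' : ℝ≥0∞, M < M' ∧ weightedSnd w ρ = M' • ν := by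
  have hMt : M ≠ ∞ := hlt.ne_top
  have hWfin : IsFiniteMeasure (weightedSnd w π) := ⟨by
    rw [weightedSnd_univ]
    calc _ ≤ ∫⁻ _, 1 ∂π := lintegral_mono hw1
      _ < ∞ := by simp⟩
  have hMfin : IsFiniteMeasure (M • ν) := Measure.smul_finite _ hMt
  -- The density of `M • ν` with respect to the larger measure is at most 1 only almost everywhere;
  -- the minimum with 1 makes the bound hold everywhere, so that `1 - f` is a true complement.
  obtain ⟨f, hf, hf1, hfM⟩ : ∃ f : Y → ℝ≥0∞, Measurable f ∧ (∀ y, f y ≤ 1) ∧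
      (weightedSnd w π).withDensity f = M • ν := by
    refine ⟨fun y => min ((M • ν).rnDeriv (weightedSnd w π) y) 1,
      (Measure.measurable_rnDeriv _ _).min measurable_const, fun y => min_le_right _ _, ?_⟩
    rw [← Measure.withDensity_rnDeriv_eq (M • ν) (weightedSnd w π)
      (Measure.absolutelyContinuous_of_le hle)]
    refine withDensity_congr_ae ?_
    filter_upwards [Measure.rnDeriv_le_one_of_le hle] with y hy
    rw [Measure.withDensity_rnDeriv_eq (M • ν) (weightedSnd w π)
      (Measure.absolutelyContinuous_of_le hle)]
    exact min_eq_left hy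
  have hf' : Measurable (fun p : X × Y => f p.2) := hf.comp measurable_snd
  set π₁ := π.withDensity (fun p => f p.2) with hπ₁
  set π₂ := π.withDensity (fun p => 1 - f p.2) with hπ₂
  have hsplit : π₁ + π₂ = π := by
    rw [hπ₁, hπ₂, ← withDensity_add_left hf']
    convert withDensity_one (μ := π) using 2
    funext p
    simpa using add_tsub_cancel_of_le (hf1 p.2)
  have hW₁ : weightedSnd w π₁ = M • ν := by rw [hπ₁, weightedSnd_withDensity_snd hw hf, hfM]
  have hfin₂ : IsFiniteMeasure π₂ := by
    refine isFiniteMeasure_of_le π ?_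
    rw [← hsplit]; exact Measure.le_add_left le_rfl
  -- If nothing were thinned out, the weighted mass of `π` would be exactly `M`, against the strict
  -- inequality.
  have hθ : π₂.map Prod.fst ≠ 0 := by
    intro h0
    rw [Measure.map_eq_zero_iff measurable_fst.aemeasurable] at h0
    rw [h0, add_zero] at hsplit
    rw [← hsplit, hW₁] at hlt
    simp at hlt
  obtain ⟨τ, hτ, t, ht, hWτ⟩ := exists_transport hw hd hdw hw1 ν (π₂.map Prod.fst) hθ
  refine ⟨π₁ + τ, ?_, M + t, ENNReal.lt_add_right hMt ht, ?_⟩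
  · rw [Measure.map_add _ _ measurable_fst, hτ, ← Measure.map_add _ _ measurable_fst, hsplit]
  · rw [weightedSnd_add, hW₁, hWτ, add_smul]

end Weighted

/-! ### Rerouting mass along a cycle -/

section Perturbation

variable {X Y : Type*} [MeasurableSpace X] [MeasurableSpace Y]

lemma weightedSnd_le_of_ae_le {w : X × Y → ℝ≥0∞} {π : Measure (X × Y)} {r : ℝ≥0∞}
    (h : ∀ᵐ p ∂π, w p ≤ r) : weightedSnd w π ≤ r • π.map Prod.snd := by
  refine Measure.le_iff.2 fun B hB => ?_
  rw [weightedSnd_apply _ _ hB, Measure.smul_apply, Measure.map_apply measurable_snd hB,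
    smul_eq_mul, ← setLIntegral_const]
  exact lintegral_mono_ae (ae_restrict_of_ae h)

lemma le_weightedSnd_of_ae_le {w : X × Y → ℝ≥0∞} {π : Measure (X × Y)} {q : ℝ≥0∞}
    (h : ∀ᵐ p ∂π, q ≤ w p) : q • π.map Prod.snd ≤ weightedSnd w π := by
  refine Measure.le_iff.2 fun B hB => ?_
  rw [weightedSnd_apply _ _ hB, Measure.smul_apply, Measure.map_apply measurable_snd hB,
    smul_eq_mul, ← setLIntegral_const]
  exact lintegral_mono_ae (ae_restrict_of_ae h)

/-- Rerouting mass along a cycle of boxes on which the weights increase. -/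
lemma exists_rerouting {w : X × Y → ℝ≥0∞} (hw1 : ∀ p, w p ≤ 1)
    (π : Measure (X × Y)) [IsFiniteMeasure π]
    {ι : Type*} [Fintype ι] [Nonempty ι] (σ : Equiv.Perm ι) (U : ι → Set X) (V : ι → Set Y)
    (hU : ∀ i, MeasurableSet (U i)) (hV : ∀ i, MeasurableSet (V i))
    (hUV : ∀ i, π (U i ×ˢ V i) ≠ 0) (a q r : ι → ℝ≥0∞) (ha : ∀ i, a i ≠ 0) (ha' : ∀ i, a i ≠ ∞)
    (hq : ∀ i, ∀ x ∈ U (σ i), ∀ y ∈ V i, q i ≤ w (x, y))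
    (hr : ∀ i, ∀ x ∈ U i, ∀ y ∈ V i, w (x, y) ≤ r i)
    (haqr : ∀ i, a i * r i < a (σ i) * q i) :
    ∃ π' : Measure (X × Y), IsFiniteMeasure π' ∧ π'.map Prod.fst = π.map Prod.fst ∧
      weightedSnd w π ≤ weightedSnd w π' ∧
      weightedSnd w π Set.univ < weightedSnd w π' Set.univ := by
  set E : ι → Set (X × Y) := fun i => U i ×ˢ V i with hE
  have hEm : ∀ i, MeasurableSet (E i) := fun i => (hU i).prod (hV i)
  set κ : ι → Measure (X × Y) := fun i => ProbabilityTheory.cond π (E i) with hκ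
  have hκp : ∀ i, IsProbabilityMeasure (κ i) := fun i =>
    ProbabilityTheory.cond_isProbabilityMeasure (hUV i)
  have hκE : ∀ i, ∀ᵐ p ∂(κ i), p ∈ E i := fun i => ProbabilityTheory.ae_cond_mem (hEm i)
  set α : ι → Measure X := fun i => (κ i).map Prod.fst with hα
  set γ : ι → Measure Y := fun i => (κ i).map Prod.snd with hγ
  have hαp : ∀ i, IsProbabilityMeasure (α i) := fun i =>
    Measure.isProbabilityMeasure_map measurable_fst.aemeasurable
  have hγp : ∀ i, IsProbabilityMeasure (γ i) := fun i =>
    Measure.isProbabilityMeasure_map measurable_snd.aemeasurable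
  have hαU : ∀ i, ∀ᵐ x ∂(α i), x ∈ U i := fun i => by
    refine (ae_map_iff measurable_fst.aemeasurable (hU i)).2 ?_
    filter_upwards [hκE i] with p hp using hp.1
  have hγV : ∀ i, ∀ᵐ y ∂(γ i), y ∈ V i := fun i => by
    refine (ae_map_iff measurable_snd.aemeasurable (hV i)).2 ?_
    filter_upwards [hκE i] with p hp using hp.2
  -- Each conditioned measure satisfies `κ i ≤ (π (E i))⁻¹ • π`, so dividing by `s` keeps the
  -- removed mass `R` below `π`, even when boxes overlap.
  set s : ℝ≥0∞ := ∑ i, a i * (π (E i))⁻¹ with hs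
  have hs0 : s ≠ 0 := by
    rw [hs, Ne, Finset.sum_eq_zero_iff]
    intro h
    obtain ⟨i⟩ := ‹Nonempty ι›
    exact mul_ne_zero (ha i) (ENNReal.inv_ne_zero.2 (measure_ne_top _ _)) (h i (Finset.mem_univ i))
  have hst : s ≠ ∞ := by
    rw [hs]
    exact ENNReal.sum_ne_top.2 fun i _ => ENNReal.mul_ne_top (ha' i) (ENNReal.inv_ne_top.2 (hUV i))
  have he0 : s⁻¹ ≠ 0 := ENNReal.inv_ne_zero.2 hst
  have het : s⁻¹ ≠ ∞ := ENNReal.inv_ne_top.2 hs0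
  set R : Measure (X × Y) := s⁻¹ • ∑ i, a i • κ i with hR
  -- Source `σ i` is now coupled with target `i`, with the coefficient of the source. Reindexing by
  -- `σ` preserves the first marginal; the unweighted second marginal is allowed to change.
  set S : Measure (X × Y) := s⁻¹ • ∑ i, a (σ i) • (α (σ i)).prod (γ i) with hS
  have hRπ : R ≤ π := by
    refine Measure.le_iff.2 fun B hB => ?_
    have : ∀ i, a i * κ i B ≤ a i * (π (E i))⁻¹ * π B := fun i => by
      rw [hκ, ProbabilityTheory.cond_apply (hEm i), mul_assoc]
      gcongr
      exact Set.inter_subset_right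
    calc R B = s⁻¹ * ∑ i, a i * κ i B := by simp [hR, Measure.finsetSum_apply]
      _ ≤ s⁻¹ * ∑ i, a i * (π (E i))⁻¹ * π B := 
          mul_le_mul' le_rfl (Finset.sum_le_sum fun i _ => this i)
      _ = s⁻¹ * s * π B := by rw [← Finset.sum_mul, hs, mul_assoc]
      _ = π B := by rw [ENNReal.inv_mul_cancel hs0 hst, one_mul]
  have hRfin : IsFiniteMeasure R := isFiniteMeasure_of_le π hRπ
  have hSfin : IsFiniteMeasure S := ⟨by
    simp only [hS, Measure.smul_apply, Measure.finsetSum_apply, measure_univ, smul_eq_mul, mul_one]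
    exact (ENNReal.mul_ne_top het (ENNReal.sum_ne_top.2 fun i _ => ha' _)).lt_top⟩
  have hfst : S.map Prod.fst = R.map Prod.fst := by
    have h1 : ∀ B, MeasurableSet B → S.map Prod.fst B = s⁻¹ * ∑ i, a (σ i) * α (σ i) B := by
      intro B hB
      rw [Measure.map_apply measurable_fst hB, hS, ← Set.prod_univ]
      simp [Measure.finsetSum_apply, Measure.prod_prod]
    have h2 : ∀ B, MeasurableSet B → R.map Prod.fst B = s⁻¹ * ∑ i, a i * α i B := by
      intro B hB
      rw [Measure.map_apply measurable_fst hB, hR]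
      simp [Measure.finsetSum_apply, hα, Measure.map_apply measurable_fst hB]
    ext B hB
    rw [h1 B hB, h2 B hB, Equiv.sum_comp σ (fun i => a i * α i B)]
  have hWR : ∀ B, weightedSnd w R B ≤ s⁻¹ * ∑ i, a i * r i * γ i B := fun B => by
    rw [hR, weightedSnd_smul, weightedSnd_sum, Measure.smul_apply, Measure.finsetSum_apply,
      smul_eq_mul]
    gcongr with i
    rw [weightedSnd_smul, Measure.smul_apply, smul_eq_mul, mul_assoc]
    gcongr
    refine weightedSnd_le_of_ae_le ?_ B
    filter_upwards [hκE i] with p hp using hr i _ hp.1 _ hp.2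
  have hWS : ∀ B, s⁻¹ * ∑ i, a (σ i) * q i * γ i B ≤ weightedSnd w S B := fun B => by
    rw [hS, weightedSnd_smul, weightedSnd_sum, Measure.smul_apply, Measure.finsetSum_apply,
      smul_eq_mul]
    gcongr with i
    rw [weightedSnd_smul, Measure.smul_apply, smul_eq_mul, mul_assoc]
    gcongr
    have hsnd : ((α (σ i)).prod (γ i)).map Prod.snd = γ i := by
      rw [Measure.map_snd_prod, measure_univ, one_smul]
    have := le_weightedSnd_of_ae_le (w := w) (π := (α (σ i)).prod (γ i)) (q := q i) (by
      filter_upwards [Measure.quasiMeasurePreserving_fst.ae (hαU (σ i)),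
        Measure.quasiMeasurePreserving_snd.ae (hγV i)] with p hp1 hp2 using hq i _ hp1 _ hp2) B
    rwa [hsnd] at this
  have hsplit : (π - R) + R = π := Measure.sub_add_cancel_of_le hRπ
  have hξfin : IsFiniteMeasure (π - R) := inferInstance
  have hξW : weightedSnd w (π - R) Set.univ ≠ ∞ := by
    rw [weightedSnd_univ]
    refine ne_top_of_le_ne_top (measure_ne_top (π - R) Set.univ) ?_
    calc _ ≤ ∫⁻ _, 1 ∂(π - R) := lintegral_mono hw1
      _ = _ := by simp
  refine ⟨(π - R) + S, inferInstance, ?_, ?_, ?_⟩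
  · rw [Measure.map_add _ _ measurable_fst, hfst, ← Measure.map_add _ _ measurable_fst, hsplit]
  · conv_lhs => rw [← hsplit]
    rw [weightedSnd_add, weightedSnd_add]
    gcongr
    refine Measure.le_iff'.2 fun B => (hWR B).trans (le_trans ?_ (hWS B))
    exact mul_le_mul' le_rfl (Finset.sum_le_sum fun i _ => mul_le_mul' (haqr i).le le_rfl)
  · conv_lhs => rw [← hsplit]
    rw [weightedSnd_add, weightedSnd_add, Measure.add_apply, Measure.add_apply]
    refine ENNReal.add_lt_add_left hξW ((hWR _).trans_lt (lt_of_lt_of_le ?_ (hWS _)))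
    simp only [measure_univ, mul_one]
    refine (ENNReal.mul_lt_mul_iff_right he0 het).2 ?_
    exact ENNReal.sum_lt_sum_of_nonempty Finset.univ_nonempty fun i _ => haqr i

end Perturbation

/-! ### Plans as measures with weighted marginal proportional to `ν` -/

section Plans

/-- The weight `m` as an extended nonnegative function on the product. -/
noncomputable def weight {X Y : Type*} (m : X → Y → ℝ) (p : X × Y) : ℝ≥0∞ :=
  ENNReal.ofReal (m p.1 p.2)

lemma weight_le_one {X Y : Type*} {m : X → Y → ℝ} (hm1 : ∀ x y, m x y ≤ 1) (p : X × Y) :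
    weight m p ≤ 1 := by
  rw [weight, ← ENNReal.ofReal_one]
  exact ENNReal.ofReal_le_ofReal (hm1 _ _)

variable {X Y : Type*} [MeasurableSpace X] [MeasurableSpace Y]

variable {m : X → Y → ℝ} {d : ℝ}

lemma measurable_weight (hm : Measurable fun p : X × Y => m p.1 p.2) : Measurable (weight m) :=
  hm.ennreal_ofReal

lemma setIntegral_eq_weightedSnd (hm : Measurable fun p : X × Y => m p.1 p.2)
    (hm0 : ∀ x y, 0 ≤ m x y) (π : Measure (X × Y)) {B : Set Y} (hB : MeasurableSet B) :
    ∫ p in Set.univ ×ˢ B, m p.1 p.2 ∂π = (weightedSnd (weight m) π B).toReal := by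
  rw [Set.univ_prod, weightedSnd_apply _ _ hB,
    integral_eq_lintegral_of_nonneg_ae (Filter.Eventually.of_forall fun p => hm0 _ _)
      hm.aestronglyMeasurable]
  rfl

lemma integral_eq_weightedSnd (hm : Measurable fun p : X × Y => m p.1 p.2)
    (hm0 : ∀ x y, 0 ≤ m x y) (π : Measure (X × Y)) :
    ∫ p, m p.1 p.2 ∂π = (weightedSnd (weight m) π Set.univ).toReal := by
  rw [← setIntegral_eq_weightedSnd hm hm0 π MeasurableSet.univ]
  simp

lemma weightedSnd_univ_le_one {w : X × Y → ℝ≥0∞} (hw1 : ∀ p, w p ≤ 1) (π : Measure (X × Y))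
    [IsProbabilityMeasure π] : weightedSnd w π Set.univ ≤ 1 := by
  rw [weightedSnd_univ]
  calc _ ≤ ∫⁻ _, 1 ∂π := lintegral_mono hw1
    _ = 1 := by simp

lemma weightedSnd_univ_pos {w : X × Y → ℝ≥0∞} {d : ℝ≥0∞} (hd : d ≠ 0) (hdw : ∀ p, d ≤ w p)
    (π : Measure (X × Y)) [IsProbabilityMeasure π] : weightedSnd w π Set.univ ≠ 0 := by
  rw [weightedSnd_univ]
  refine (hd.bot_lt.trans_le ?_).ne'
  calc d = ∫⁻ _, d ∂π := by simp
    _ ≤ _ := lintegral_mono hdw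

/-- The bounds `0 < d ≤ m ≤ 1` make the denominator positive and finite, so the quotient can be
cleared. The factor `M` is then the total transported mass, as evaluation on the whole space shows.
-/
lemma mem_plans_iff (hm : Measurable fun p : X × Y => m p.1 p.2) (hd : 0 < d)
    (hdm : ∀ x y, d ≤ m x y) (hm1 : ∀ x y, m x y ≤ 1) {μ : Measure X} {ν : Measure Y}
    [IsProbabilityMeasure ν] {π : Measure (X × Y)} :
    π ∈ plans m μ ν ↔ IsProbabilityMeasure π ∧ π.map Prod.fst = μ ∧
      ∃ M : ℝ≥0∞, weightedSnd (weight m) π = M • ν := by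
  have hm0 : ∀ x y, 0 ≤ m x y := fun x y => hd.le.trans (hdm x y)
  refine and_congr_right fun hπ => and_congr_right fun hπμ => ?_
  have hW0 : weightedSnd (weight m) π Set.univ ≠ 0 :=
    weightedSnd_univ_pos (d := ENNReal.ofReal d) (by simpa using hd)
      (fun p => ENNReal.ofReal_le_ofReal (hdm _ _)) π
  have hWt : weightedSnd (weight m) π Set.univ ≠ ∞ :=
    ne_top_of_le_ne_top ENNReal.one_ne_top (weightedSnd_univ_le_one (weight_le_one hm1) π)
  have hWBt : ∀ B, weightedSnd (weight m) π B ≠ ∞ := fun B =>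
    ne_top_of_le_ne_top hWt (measure_mono (Set.subset_univ B))
  have hW0' := (ENNReal.toReal_pos hW0 hWt).ne'
  constructor
  · intro h
    refine ⟨weightedSnd (weight m) π Set.univ, ?_⟩
    ext B hB
    have := h B hB
    rw [setIntegral_eq_weightedSnd hm hm0 π hB, integral_eq_weightedSnd hm hm0 π,
      div_eq_iff hW0', measureReal_def, ← ENNReal.toReal_mul,
      ENNReal.toReal_eq_toReal_iff' (hWBt B) (ENNReal.mul_ne_top (by finiteness) hWt)] at this
    rw [this, Measure.smul_apply, smul_eq_mul, mul_comm]
  · rintro ⟨M, hM⟩ B hB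
    have hMu : weightedSnd (weight m) π Set.univ = M := by rw [hM]; simp
    rw [setIntegral_eq_weightedSnd hm hm0 π hB, integral_eq_weightedSnd hm hm0 π,
      div_eq_iff hW0', hMu, hM, Measure.smul_apply, smul_eq_mul, ENNReal.toReal_mul,
      measureReal_def, mul_comm]

end Plans

/-! ### Cyclical monotonicity and Rockafellar potentials -/

/-- Cyclical monotonicity of `Γ` for the cost `C`, with cycles given as initial segments of
sequences in `Γ`. -/
def IsCyclicallyMonotone {X Y : Type*} (C : X → Y → ℝ) (Γ : Set (X × Y)) : Prop :=
  ∀ (N : ℕ) (p : ℕ → X × Y), (∀ i, p i ∈ Γ) →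
    0 ≤ ∑ i ∈ Finset.range N, (C (p (i + 1)).1 (p i).2 - C (p i).1 (p i).2) +
      (C (p 0).1 (p N).2 - C (p N).1 (p N).2)

/-- The Rockafellar potential of a cyclically monotone set. -/
lemma IsCyclicallyMonotone.exists_potential {X Y : Type*} [PseudoMetricSpace X] {C : X → Y → ℝ}
    {Γ : Set (X × Y)} (hΓ : IsCyclicallyMonotone C Γ) (hne : Γ.Nonempty) {K : NNReal}
    (hC : ∀ y, LipschitzWith K fun x => C x y) :
    ∃ φ : X → ℝ, LipschitzWith K φ ∧
      ∀ p ∈ Γ, ∀ x, φ x ≤ φ p.1 + (C x p.2 - C p.1 p.2) := by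
  obtain ⟨p₀, hp₀⟩ := hne
  let I := {c : ℕ × (ℕ → X × Y) // c.2 0 = p₀ ∧ ∀ i, c.2 i ∈ Γ}
  let F : I → X → ℝ := fun c x =>
    ∑ i ∈ Finset.range c.1.1,
      (C (c.1.2 (i + 1)).1 (c.1.2 i).2 - C (c.1.2 i).1 (c.1.2 i).2) +
      (C x (c.1.2 c.1.1).2 - C (c.1.2 c.1.1).1 (c.1.2 c.1.1).2)
  have : Nonempty I := ⟨⟨(0, fun _ => p₀), rfl, fun _ => hp₀⟩⟩
  have hCle : ∀ x x' y, C x y ≤ C x' y + K * dist x x' := fun x x' y => by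
    have := (hC y).dist_le_mul x x'
    rw [Real.dist_eq] at this
    linarith [le_abs_self (C x y - C x' y)]
  have hFle : ∀ c x x', F c x ≤ F c x' + K * dist x x' := fun c x x' => by
    have := hCle x x' (c.1.2 c.1.1).2
    simp only [F]
    linarith
  have hbdd : ∀ x, BddBelow (Set.range fun c => F c x) := fun x => by
    refine ⟨-(K * dist p₀.1 x), ?_⟩
    rintro _ ⟨c, rfl⟩
    -- Evaluating a chain at its base point closes it into a cycle. The Lipschitz bound carries this
    -- lower bound to every other point.
    have h0 : 0 ≤ F c p₀.1 := by
      have := hΓ c.1.1 c.1.2 c.2.2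
      rwa [c.2.1] at this
    have := hFle c p₀.1 x
    simp only
    linarith
  refine ⟨fun x => ⨅ c, F c x, LipschitzWith.of_le_add_mul K fun x x' => ?_, ?_⟩
  · rw [← sub_le_iff_le_add]
    refine le_ciInf fun c => ?_
    linarith [ciInf_le (hbdd x) c, hFle c x x']
  · intro p hp x
    rw [← sub_le_iff_le_add]
    refine le_ciInf fun c => ?_
    -- Appending `p` to an arbitrary chain adds exactly the increment in the claim; the values of
    -- the sequence beyond the new end are irrelevant.
    let c' : I := ⟨(c.1.1 + 1, fun i => if i ≤ c.1.1 then c.1.2 i else p),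
      by simpa using c.2.1, fun i => by
        by_cases h : i ≤ c.1.1
        · simpa [h] using c.2.2 i
        · simpa [h] using hp⟩
    have hF : F c' x = F c p.1 + (C x p.2 - C p.1 p.2) := by
      simp only [F, c']
      rw [Finset.sum_range_succ]
      have : ∀ i ∈ Finset.range c.1.1,
          (C (if i + 1 ≤ c.1.1 then c.1.2 (i + 1) else p).1
            (if i ≤ c.1.1 then c.1.2 i else p).2 -
          C (if i ≤ c.1.1 then c.1.2 i else p).1 (if i ≤ c.1.1 then c.1.2 i else p).2) =
          C (c.1.2 (i + 1)).1 (c.1.2 i).2 - C (c.1.2 i).1 (c.1.2 i).2 := by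
        intro i hi
        have hi := Finset.mem_range.1 hi
        rw [if_pos (Nat.succ_le_of_lt hi), if_pos hi.le]
      rw [Finset.sum_congr rfl this]
      simp
    have := ciInf_le (hbdd x) c'
    linarith

/-! ### Maximal plans have cyclically monotone support -/

section Optimal

variable {X Y : Type*} [MeasurableSpace X] [MeasurableSpace Y] [PseudoMetricSpace X]
  [PseudoMetricSpace Y] [OpensMeasurableSpace X] [OpensMeasurableSpace Y]
  {m : X → Y → ℝ} {d : ℝ}

/-- Along the support of a plan of maximal transported mass, no cycle increases the weights. -/
lemma not_exists_improving_cycle (hmc : Continuous fun p : X × Y => m p.1 p.2)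
    (hm : Measurable fun p : X × Y => m p.1 p.2) (hd : 0 < d)
    (hdm : ∀ x y, d ≤ m x y) (hm1 : ∀ x y, m x y ≤ 1) {μ : Measure X} {ν : Measure Y}
    [IsProbabilityMeasure ν] {π : Measure (X × Y)} (hπ : π ∈ plans m μ ν)
    (hopt : ∀ ρ ∈ plans m μ ν, weightedSnd (weight m) ρ Set.univ ≤
      weightedSnd (weight m) π Set.univ)
    {ι : Type*} [Fintype ι] [Nonempty ι] (σ : Equiv.Perm ι) (p : ι → X × Y)
    (hp : ∀ i, p i ∈ π.support) (a : ι → ℝ) (ha : ∀ i, 0 < a i) :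
    ¬ ∀ i, a i * m (p i).1 (p i).2 < a (σ i) * m (p (σ i)).1 (p i).2 := by
  intro hlt
  obtain ⟨hπp, hπμ, M, hM⟩ := (mem_plans_iff hm hd hdm hm1).1 hπ
  have hqr : ∀ i, ∃ r q : ℝ, m (p i).1 (p i).2 < r ∧ q < m (p (σ i)).1 (p i).2 ∧ 0 < q ∧
      a i * r < a (σ i) * q := fun i => by
    -- Two intermediate values leave room on both sides: the strict inequality then survives on
    -- small balls around the points.
    obtain ⟨t, ht1, ht2⟩ := exists_between (hlt i)
    obtain ⟨s, hs1, hs2⟩ := exists_between ht2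
    have h0 : 0 < a i * m (p i).1 (p i).2 := mul_pos (ha i) (hd.trans_le (hdm _ _))
    refine ⟨t / a i, s / a (σ i), ?_, ?_, ?_, ?_⟩
    · rwa [lt_div_iff₀ (ha i), mul_comm]
    · rwa [div_lt_iff₀ (ha _), mul_comm]
    · exact div_pos (by linarith) (ha _)
    · rwa [mul_div_cancel₀ _ (ha i).ne', mul_div_cancel₀ _ (ha _).ne']
  choose r q hr hq hq0 hrq using hqr
  have hball : ∀ {O : Set (X × Y)}, IsOpen O → ∀ z ∈ O,
      ∀ᶠ ε in nhdsWithin (0 : ℝ) (Set.Ioi 0), Metric.ball z ε ⊆ O := by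
    intro O hO z hz
    obtain ⟨ε, hε, hεO⟩ := Metric.isOpen_iff.1 hO z hz
    filter_upwards [Ioo_mem_nhdsGT hε] with ε' hε'
    exact (Metric.ball_subset_ball hε'.2.le).trans hεO
  have hev : ∀ᶠ ε in nhdsWithin (0 : ℝ) (Set.Ioi 0), 0 < ε ∧ ∀ i,
      Metric.ball (p i) ε ⊆ {z | m z.1 z.2 < r i} ∧
      Metric.ball ((p (σ i)).1, (p i).2) ε ⊆ {z | q i < m z.1 z.2} := by
    refine (eventually_mem_nhdsWithin).and (Filter.eventually_all.2 fun i => ?_)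
    exact (hball (isOpen_lt hmc continuous_const) _ (hr i)).and
      (hball (isOpen_lt continuous_const hmc) _ (hq i))
  obtain ⟨ε, hε, hU⟩ := hev.exists
  obtain ⟨π', hfin, hfst, hle, hlt'⟩ := exists_rerouting (weight_le_one hm1) π σ
    (fun i => Metric.ball (p i).1 ε) (fun i => Metric.ball (p i).2 ε)
    (fun i => measurableSet_ball) (fun i => measurableSet_ball)
    (fun i => by
      rw [ball_prod_same]
      exact ((Measure.mem_support_iff_forall _).1 (hp i) _ (Metric.ball_mem_nhds _ hε)).ne')
    (fun i => ENNReal.ofReal (a i)) (fun i => ENNReal.ofReal (q i))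
    (fun i => ENNReal.ofReal (r i)) (fun i => by simpa using ha i)
    (fun i => ENNReal.ofReal_ne_top)
    (fun i x hx y hy => ENNReal.ofReal_le_ofReal (by
      have : (x, y) ∈ Metric.ball ((p (σ i)).1, (p i).2) ε := by
        rw [← ball_prod_same]; exact ⟨hx, hy⟩
      exact ((hU i).2 this).le))
    (fun i x hx y hy => ENNReal.ofReal_le_ofReal (by
      have : (x, y) ∈ Metric.ball (p i) ε := by
        rw [← Prod.mk.eta (p := p i), ← ball_prod_same]; exact ⟨hx, hy⟩
      exact ((hU i).1 this).le))
    (fun i => by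
      rw [← ENNReal.ofReal_mul (ha _).le, ← ENNReal.ofReal_mul (ha _).le]
      exact (ENNReal.ofReal_lt_ofReal_iff (mul_pos (ha _) (hq0 i))).2 (hrq i))
  have hMu : weightedSnd (weight m) π Set.univ = M := by rw [hM]; simp
  rw [hMu] at hlt'
  rw [hM] at hle
  obtain ⟨ρ, hρ, M', hM', hρW⟩ := exists_better_transport (measurable_weight hm)
    (d := ENNReal.ofReal d) (by simpa using hd) (fun p => ENNReal.ofReal_le_ofReal (hdm _ _))
    (weight_le_one hm1) ν π' hle hlt'
  have hρμ : ρ.map Prod.fst = μ := by rw [hρ, hfst, hπμ]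
  have hμp : IsProbabilityMeasure μ := by
    rw [← hπμ]; exact Measure.isProbabilityMeasure_map measurable_fst.aemeasurable
  have hρp : IsProbabilityMeasure ρ := by
    refine ⟨?_⟩
    rw [← measure_univ (μ := μ), ← hρμ, Measure.map_apply measurable_fst MeasurableSet.univ,
      Set.preimage_univ]
  have := hopt ρ ((mem_plans_iff hm hd hdm hm1).2 ⟨hρp, hρμ, M', hρW⟩)
  rw [hρW, hMu] at this
  simp only [Measure.smul_apply, measure_univ, smul_eq_mul, mul_one] at this
  exact this.not_gt hM'

/-- The support of a plan of maximal transported mass is cyclically monotone for `-log m`. -/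
lemma isCyclicallyMonotone_support (hmc : Continuous fun p : X × Y => m p.1 p.2)
    (hm : Measurable fun p : X × Y => m p.1 p.2) (hd : 0 < d)
    (hdm : ∀ x y, d ≤ m x y) (hm1 : ∀ x y, m x y ≤ 1) {μ : Measure X} {ν : Measure Y}
    [IsProbabilityMeasure ν] {π : Measure (X × Y)} (hπ : π ∈ plans m μ ν)
    (hopt : ∀ ρ ∈ plans m μ ν, weightedSnd (weight m) ρ Set.univ ≤
      weightedSnd (weight m) π Set.univ) :
    IsCyclicallyMonotone (fun x y => -Real.log (m x y)) π.support := by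
  intro N p hp
  by_contra! hneg
  set C : X → Y → ℝ := fun x y => -Real.log (m x y) with hC
  -- The deficit of the cycle is spread evenly over its `N + 1` edges. With log-weights `b`, every
  -- edge, including the closing one, gains exactly `η`.
  set η : ℝ := -(∑ i ∈ Finset.range N, (C (p (i + 1)).1 (p i).2 - C (p i).1 (p i).2) +
      (C (p 0).1 (p N).2 - C (p N).1 (p N).2)) / (N + 1) with hη
  have hη0 : 0 < η := div_pos (by linarith) (by positivity)
  have hηN : η * (N + 1) = -(∑ i ∈ Finset.range N, (C (p (i + 1)).1 (p i).2 - C (p i).1 (p i).2) +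
      (C (p 0).1 (p N).2 - C (p N).1 (p N).2)) := by
    rw [hη]; field_simp
  set b : ℕ → ℝ := fun i =>
    ∑ j ∈ Finset.range i, (C (p (j + 1)).1 (p j).2 - C (p j).1 (p j).2 + η) with hb
  have hmexp : ∀ x y, m x y = Real.exp (-C x y) := fun x y => by
    simp [hC, Real.exp_log (hd.trans_le (hdm x y))]
  refine not_exists_improving_cycle hmc hm hd hdm hm1 hπ hopt (finRotate (N + 1))
    (fun i => p i) (fun i => hp i) (fun i => Real.exp (b i)) (fun i => Real.exp_pos _) fun i => ?_
  rw [hmexp, hmexp, ← Real.exp_add, ← Real.exp_add]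
  refine Real.exp_lt_exp.2 ?_
  rcases Fin.eq_castSucc_or_eq_last i with ⟨j, rfl⟩ | rfl
  · have hj : ((finRotate (N + 1) j.castSucc : Fin (N + 1)) : ℕ) = j + 1 := by
      rw [finRotate_apply, Fin.coeSucc_eq_succ, Fin.val_succ]
    rw [hj]
    simp only [Fin.val_castSucc]
    have : b (j + 1) = b j + (C (p (j + 1)).1 (p j).2 - C (p j).1 (p j).2 + η) := by
      rw [hb]; exact Finset.sum_range_succ _ _
    linarith
  · rw [finRotate_last]
    have h0 : b 0 = 0 := by simp [hb]
    have hN : b N = ∑ j ∈ Finset.range N, (C (p (j + 1)).1 (p j).2 - C (p j).1 (p j).2) +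
        N * η := by
      rw [hb]; simp [Finset.sum_add_distrib]
    simp only [Fin.val_last, Fin.val_zero, h0, hN]
    linarith

end Optimal

/-- The potential inequality at each point, tested at the source of its predecessor, telescopes
around the cycle. The perturbation argument therefore need not be repeated with the roles of the two
spaces exchanged. -/
lemma isCyclicallyMonotone_swap_of_potential {X Y : Type*} {C : X → Y → ℝ} {Γ : Set (X × Y)}
    {φ : X → ℝ} (hφ : ∀ p ∈ Γ, ∀ x, φ x ≤ φ p.1 + (C x p.2 - C p.1 p.2)) :
    IsCyclicallyMonotone (fun y x => C x y) (Prod.swap ⁻¹' Γ) := by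
  intro N p hp
  have key : ∀ i x, φ x ≤ φ (p i).2 + (C x (p i).1 - C (p i).2 (p i).1) := fun i => hφ _ (hp i)
  have hsum : ∀ N : ℕ, φ (p 0).2 - φ (p N).2 + C (p N).2 (p N).1 - C (p 0).2 (p 0).1 ≤
      ∑ i ∈ Finset.range N, (C (p i).2 (p (i + 1)).1 - C (p i).2 (p i).1) := by
    intro N
    induction N with
    | zero => simp
    | succ N ih =>
      rw [Finset.sum_range_succ]
      linarith [key (N + 1) (p N).2]
  linarith [hsum N, key 0 (p N).2]

/-! ### Measures carried by graphs -/

/-- A measure on a product of compact metric spaces which is concentrated on a compact set with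
almost surely single-valued sections is induced by a measurable map. -/
lemma exists_measurable_map_of_single_valued {X Y : Type*} [MeasurableSpace X]
    [MeasurableSpace Y] [MetricSpace X] [MetricSpace Y] [CompactSpace X] [CompactSpace Y]
    [BorelSpace X] [BorelSpace Y] [Nonempty Y] (π : Measure (X × Y)) {Γ : Set (X × Y)}
    (hΓ : IsClosed Γ) (hπΓ : ∀ᵐ p ∂π, p ∈ Γ)
    (hsv : ∀ᵐ x ∂(π.map Prod.fst), ∀ y y', (x, y) ∈ Γ → (x, y') ∈ Γ → y = y') :
    ∃ T : X → Y, Measurable T ∧ π = (π.map Prod.fst).map (fun x => (x, T x)) := by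
  classical
  obtain ⟨t, hts, htm, ht0⟩ := exists_measurable_superset_of_null hsv
  have htu : ∀ x ∉ t, ∀ y y', (x, y) ∈ Γ → (x, y') ∈ Γ → y = y' := fun x hx => by
    by_contra h
    exact hx (hts h)
  let T : X → Y := fun x =>
    if h : x ∉ t ∧ ∃ y, (x, y) ∈ Γ then h.2.choose else Classical.arbitrary Y
  have hT : ∀ p ∈ Γ, p.1 ∉ t → T p.1 = p.2 := by
    rintro ⟨x, y⟩ hp hx
    have h : x ∉ t ∧ ∃ y, (x, y) ∈ Γ := ⟨hx, y, hp⟩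
    simp only [T, dif_pos h]
    exact htu x hx _ _ h.2.choose_spec hp
  -- Compactness replaces measurable selection: projections of closed sets are closed, so preimages
  -- of closed sets under `T` are Borel off the null set `t`.
  have hproj : ∀ C : Set Y, IsClosed C → MeasurableSet (Prod.fst '' (Γ ∩ Prod.snd ⁻¹' C)) :=
    fun C hC => ((hΓ.inter (hC.preimage continuous_snd)).isCompact.image
      continuous_fst).isClosed.measurableSet
  have hTm : Measurable T := by
    refine measurable_of_isClosed fun C hC => ?_
    have hset : T ⁻¹' C = (tᶜ ∩ Prod.fst '' (Γ ∩ Prod.snd ⁻¹' C)) ∪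
        ((tᶜ ∩ Prod.fst '' (Γ ∩ Prod.snd ⁻¹' Set.univ))ᶜ ∩ {_x | Classical.arbitrary Y ∈ C}) := by
      ext x
      by_cases h : x ∉ t ∧ ∃ y, (x, y) ∈ Γ
      · obtain ⟨hx, y, hy⟩ := h
        have hTx : T x = y := hT _ hy hx
        have : ∀ y', (x, y') ∈ Γ ↔ y' = y :=
          fun y' => ⟨fun h' => htu x hx _ _ h' hy, fun h' => h' ▸ hy⟩
        simp [hTx, hx, this]
      · have hTx : T x = Classical.arbitrary Y := by simp only [T, dif_neg h]
        push Not at h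
        by_cases hx : x ∈ t
        · simp [hTx, hx]
        · simp [hTx, hx, h hx]
    rw [hset]
    exact (htm.compl.inter (hproj C hC)).union
      ((htm.compl.inter (hproj _ isClosed_univ)).compl.inter (MeasurableSet.const _))
  refine ⟨T, hTm, ?_⟩
  have hπt : ∀ᵐ p ∂π, p.1 ∉ t := ae_of_ae_map measurable_fst.aemeasurable
    (measure_eq_zero_iff_ae_notMem.1 ht0)
  rw [Measure.map_map (show Measurable fun x => (x, T x) from measurable_id.prodMk hTm)
    measurable_fst]
  conv_lhs => rw [← Measure.map_id (μ := π)]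
  refine Measure.map_congr ?_
  filter_upwards [hπΓ, hπt] with p hp hpt
  exact Prod.ext rfl (hT p hp hpt).symm

/-! ### The logarithmic cost: gradient, twist and Lipschitz bound -/

section Leaky

variable {n : ℕ} {k : ℝ}

local notation "E" => EuclideanSpace ℝ (Fin n)

lemma leakyFactor_comm (x y : E) : leakyFactor k x y = leakyFactor k y x := by
  rw [leakyFactor, leakyFactor, norm_sub_rev]

lemma hasFDerivAt_neg_log_leakyFactor {x y : E} (h : 0 < leakyFactor k x y) :
    HasFDerivAt (fun x' => -Real.log (leakyFactor k x' y))
      ((k / leakyFactor k x y) • innerSL ℝ (x - y)) x := by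
  have h1 : HasFDerivAt (fun x' : E => ‖x' - y‖ ^ 2)
      (2 • (innerSL ℝ (x - y)).comp (ContinuousLinearMap.id ℝ E)) x :=
    ((hasFDerivAt_id x).sub_const y).norm_sq
  have h2 := (((h1.const_mul (k / 2)).const_sub 1).log h.ne').neg
  refine h2.congr_fderiv ?_
  ext v
  simp [leakyFactor]
  ring

/-- The norm of the gradient is `k r / (1 - k r² / 2)` with `r = ‖x - y‖`, strictly increasing in
`r` while the denominator is positive. Equal gradients thus force equal distances, hence equal
factors, hence equal vectors `x - y`. -/
lemma twist {x y y' : E} (hk : 0 < k) (h : 0 < leakyFactor k x y) (h' : 0 < leakyFactor k x y')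
    (heq : (k / leakyFactor k x y) • innerSL ℝ (x - y) =
      (k / leakyFactor k x y') • innerSL ℝ (x - y')) : y = y' := by
  have hv : (k / leakyFactor k x y) • (x - y) = (k / leakyFactor k x y') • (x - y') := by
    refine ext_inner_right ℝ fun v => ?_
    have := DFunLike.congr_fun heq v
    simpa only [inner_smul_left, smul_apply, innerSL_apply_apply,
      smul_eq_mul, conj_trivial] using this
  have aux : ∀ {y y' : E}, 0 < leakyFactor k x y → 0 < leakyFactor k x y' →
      (k / leakyFactor k x y) • (x - y) = (k / leakyFactor k x y') • (x - y') →
      ‖x - y'‖ ≤ ‖x - y‖ := by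
    intro y y' h h' hv
    by_contra! hlt
    have hm : leakyFactor k x y' ≤ leakyFactor k x y := by
      unfold leakyFactor
      gcongr
    have hn := congrArg norm hv
    rw [norm_smul, norm_smul, Real.norm_of_nonneg (by positivity),
      Real.norm_of_nonneg (by positivity)] at hn
    have : k / leakyFactor k x y * ‖x - y‖ < k / leakyFactor k x y' * ‖x - y'‖ := by
      refine mul_lt_mul' ?_ hlt (norm_nonneg _) (by positivity)
      gcongr
    exact this.ne hn
  have hnorm : ‖x - y‖ = ‖x - y'‖ := le_antisymm (aux h' h hv.symm) (aux h h' hv)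
  have hm : leakyFactor k x y = leakyFactor k x y' := by rw [leakyFactor, leakyFactor, hnorm]
  rw [hm] at hv
  have := smul_right_injective E (div_pos hk h').ne' hv
  exact sub_right_injective this

lemma exists_lipschitz_neg_log_leakyFactor {X Y : Set E} (hk : 0 < k) {d : ℝ} (hd : 0 < d)
    (hdm : ∀ (x : X) (y : Y), d ≤ leakyFactor k (x : E) y) :
    ∃ K : NNReal, ∀ y : Y, LipschitzWith K fun x : X => -Real.log (leakyFactor k (x : E) y) := by
  -- Positivity of the factor already bounds `‖x - y‖` by `R`. The factor is then `k R`-Lipschitz,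
  -- and the lower bound `d` costs a further `1 / d` for the logarithm.
  set R := √(2 / k) with hR
  have hR0 : 0 ≤ R := Real.sqrt_nonneg _
  have hRle : ∀ (x : X) (y : Y), ‖(x : E) - y‖ ≤ R := fun x y => by
    refine Real.le_sqrt_of_sq_le ?_
    have := hd.trans_le (hdm x y)
    rw [leakyFactor] at this
    rw [le_div_iff₀ hk]
    linarith
  refine ⟨(k * R / d).toNNReal, fun y => LipschitzWith.of_le_add_mul _ fun x x' => ?_⟩
  rw [Real.coe_toNNReal _ (by positivity)]
  have hmx := hd.trans_le (hdm x y)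
  have hmx' := hd.trans_le (hdm x' y)
  have hdist : dist x x' = ‖(x : E) - x'‖ := by rw [Subtype.dist_eq, dist_eq_norm]
  have htri : ‖(x : E) - y‖ - ‖(x' : E) - y‖ ≤ ‖(x : E) - x'‖ := by
    have := norm_sub_norm_le ((x : E) - y) (x' - y)
    rwa [sub_sub_sub_cancel_right] at this
  have hdiff : leakyFactor k (x' : E) y - leakyFactor k (x : E) y ≤ k * R * dist x x' := by
    have h1 : leakyFactor k (x' : E) y - leakyFactor k (x : E) y =
        k / 2 * ((‖(x : E) - y‖ - ‖(x' : E) - y‖) * (‖(x : E) - y‖ + ‖(x' : E) - y‖)) := by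
      unfold leakyFactor; ring
    have h2 : (‖(x : E) - y‖ - ‖(x' : E) - y‖) * (‖(x : E) - y‖ + ‖(x' : E) - y‖) ≤
        dist x x' * (R + R) := by
      rw [hdist]
      exact mul_le_mul htri (add_le_add (hRle x y) (hRle x' y)) (by positivity) (by positivity)
    rw [h1]
    calc _ ≤ k / 2 * (dist x x' * (R + R)) := by gcongr
      _ = _ := by ring
  have hlog : Real.log (leakyFactor k (x' : E) y) - Real.log (leakyFactor k (x : E) y) ≤
      k * R / d * dist x x' := by
    rw [← Real.log_div hmx'.ne' hmx.ne']
    calc _ ≤ leakyFactor k (x' : E) y / leakyFactor k (x : E) y - 1 :=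
          Real.log_le_sub_one_of_pos (div_pos hmx' hmx)
      _ = (leakyFactor k (x' : E) y - leakyFactor k (x : E) y) / leakyFactor k (x : E) y := by
          field_simp
      _ ≤ k * R * dist x x' / leakyFactor k (x : E) y := by gcongr
      _ ≤ k * R * dist x x' / d :=
          div_le_div_of_nonneg_left (by positivity) hd (hdm x y)
      _ = _ := by ring
  linarith

/-- A measure concentrated on a closed set which has a Lipschitz potential for the cost `-log m`,
and whose first marginal is absolutely continuous, is induced by a measurable map. -/
lemma exists_measurable_map_of_potential {X Y : Set E} (hX : IsCompact X)
    (hY : IsCompact Y) (hYne : Y.Nonempty) (hfr : volume (frontier X) = 0) (hk : 0 < k)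
    {d : ℝ} (hd : 0 < d) (hdm : ∀ (x : X) (y : Y), d ≤ leakyFactor k (x : E) y)
    {π : Measure (X × Y)} (hac : (π.map Prod.fst).map Subtype.val ≪ volume)
    {Γ : Set (X × Y)} (hΓ : IsClosed Γ) (hπΓ : ∀ᵐ p ∂π, p ∈ Γ)
    {φ : X → ℝ} {K : NNReal} (hφK : LipschitzWith K φ)
    (hφ : ∀ p ∈ Γ, ∀ x : X, φ x ≤ φ p.1 +
      (-Real.log (leakyFactor k (x : E) p.2) - -Real.log (leakyFactor k (p.1 : E) p.2))) :
    ∃ T : X → Y, Measurable T ∧ π = (π.map Prod.fst).map (fun x => (x, T x)) := by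
  have := isCompact_iff_compactSpace.1 hX
  have := isCompact_iff_compactSpace.1 hY
  have := hYne.to_subtype
  refine exists_measurable_map_of_single_valued π hΓ hπΓ ?_
  have hext : ∀ x : X, Function.extend Subtype.val φ 0 (x : E) = φ x := fun x =>
    Subtype.val_injective.extend_apply _ _ _
  -- Rademacher's theorem needs a function on the whole space, so the potential is extended from `X`
  -- with the same constant.
  obtain ⟨g, hgK, hg⟩ := LipschitzOnWith.extend_real (K := K) (s := X)
    (f := Function.extend Subtype.val φ 0) (by
      rw [lipschitzOnWith_iff_restrict]
      convert hφK using 1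
      exact funext hext)
  have hgφ : ∀ x : X, g x = φ x := fun x => by rw [← hext x]; exact (hg x.2).symm
  have hae : ∀ᵐ z ∂(volume : Measure E), z ∉ frontier X ∧ DifferentiableAt ℝ g z :=
    (measure_eq_zero_iff_ae_notMem.1 hfr).and hgK.ae_differentiableAt
  filter_upwards [ae_of_ae_map measurable_subtype_coe.aemeasurable (hac.ae_le hae)]
    with x ⟨hxf, hdiff⟩ y y' hy hy'
  have hint : (x : E) ∈ interior X := by
    by_contra h
    exact hxf ⟨subset_closure x.2, h⟩
  have hfd : ∀ y : Y, (x, y) ∈ Γ →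
      fderiv ℝ g x = (k / leakyFactor k (x : E) y) • innerSL ℝ ((x : E) - y) := by
    intro y hy
    -- The potential inequality holds only on `X`; it gives a local maximum because `x` is interior,
    -- which is where the null frontier enters.
    have hmax : IsLocalMax (fun z : E => g z - -Real.log (leakyFactor k z y)) (x : E) := by
      filter_upwards [mem_interior_iff_mem_nhds.1 hint] with z hz
      have := hφ _ hy ⟨z, hz⟩
      have h1 := hgφ ⟨z, hz⟩
      have h2 := hgφ x
      simp only at this h1 h2
      linarith
    have := hmax.hasFDerivAt_eq_zero
      (hdiff.hasFDerivAt.sub (hasFDerivAt_neg_log_leakyFactor (hd.trans_le (hdm x y))))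
    exact sub_eq_zero.1 this
  exact Subtype.ext (twist hk (hd.trans_le (hdm x y)) (hd.trans_le (hdm x y'))
    ((hfd y hy).symm.trans (hfd y' hy')))

end Leaky

/-! ### Existence of plans of maximal transported mass -/

lemma integral_weightedSnd {X Y : Type*} [MeasurableSpace X] [MeasurableSpace Y]
    {m : X → Y → ℝ} (hm : Measurable fun p : X × Y => m p.1 p.2) (hm0 : ∀ x y, 0 ≤ m x y)
    (π : Measure (X × Y)) {g : Y → ℝ} (hg : Measurable g) :
    ∫ y, g y ∂(weightedSnd (weight m) π) = ∫ p, m p.1 p.2 * g p.2 ∂π := by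
  rw [weightedSnd, integral_map measurable_snd.aemeasurable hg.aestronglyMeasurable,
    integral_withDensity_eq_integral_toReal_smul (measurable_weight hm)
      (Filter.Eventually.of_forall fun p => ENNReal.ofReal_lt_top)]
  simp [weight, ENNReal.toReal_ofReal (hm0 _ _)]

section Existence

variable {X Y : Type*} [MeasurableSpace X] [MeasurableSpace Y] [MetricSpace X]
  [MetricSpace Y] [CompactSpace Y] [BorelSpace X] [BorelSpace Y]
  {m : X → Y → ℝ} {d : ℝ}

lemma plans_nonempty (hmc : Continuous fun p : X × Y => m p.1 p.2) (hd : 0 < d)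
    (hdm : ∀ x y, d ≤ m x y) (hm1 : ∀ x y, m x y ≤ 1) (μ : Measure X) (ν : Measure Y)
    [IsProbabilityMeasure μ] [IsProbabilityMeasure ν] : (plans m μ ν).Nonempty := by
  obtain ⟨τ, hτ, t, -, hW⟩ := exists_transport (measurable_weight hmc.measurable)
    (d := ENNReal.ofReal d) (by simpa using hd) (fun p => ENNReal.ofReal_le_ofReal (hdm _ _))
    (weight_le_one hm1) ν μ (IsProbabilityMeasure.ne_zero μ)
  refine ⟨τ, (mem_plans_iff hmc.measurable hd hdm hm1).2 ⟨⟨?_⟩, hτ, t, hW⟩⟩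
  rw [← measure_univ (μ := μ), ← hτ, Measure.map_apply measurable_fst MeasurableSet.univ,
    Set.preimage_univ]

/-- Finite measures are determined by bounded continuous functions. In this form both sides of the
constraint are weakly continuous in `π` on compact spaces, so the constraint is closed. -/
lemma mem_plans_iff_forall_integral (hmc : Continuous fun p : X × Y => m p.1 p.2) (hd : 0 < d)
    (hdm : ∀ x y, d ≤ m x y) (hm1 : ∀ x y, m x y ≤ 1) {μ : Measure X} {ν : Measure Y}
    [IsProbabilityMeasure ν] {π : Measure (X × Y)} [IsProbabilityMeasure π] :
    π ∈ plans m μ ν ↔ π.map Prod.fst = μ ∧ ∀ g : BoundedContinuousFunction Y ℝ,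
      ∫ p, m p.1 p.2 * g p.2 ∂π = (∫ p, m p.1 p.2 ∂π) * ∫ y, g y ∂ν := by
  have hm0 : ∀ x y, 0 ≤ m x y := fun x y => hd.le.trans (hdm x y)
  have hm := hmc.measurable
  have hWt : weightedSnd (weight m) π Set.univ ≠ ∞ :=
    ne_top_of_le_ne_top ENNReal.one_ne_top (weightedSnd_univ_le_one (weight_le_one hm1) π)
  rw [mem_plans_iff hm hd hdm hm1, and_iff_right ‹_›]
  refine and_congr_right fun _ => ⟨?_, fun h => ⟨weightedSnd (weight m) π Set.univ, ?_⟩⟩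
  · rintro ⟨M, hM⟩ g
    have hMu : weightedSnd (weight m) π Set.univ = M := by rw [hM]; simp
    rw [← integral_weightedSnd hm hm0 π g.continuous.measurable, integral_eq_weightedSnd hm hm0,
      hMu, hM, integral_smul_measure, smul_eq_mul]
  · have : IsFiniteMeasure (weightedSnd (weight m) π) := ⟨hWt.lt_top⟩
    have : IsFiniteMeasure (weightedSnd (weight m) π Set.univ • ν) := Measure.smul_finite _ hWt
    refine ext_of_forall_integral_eq_of_IsFiniteMeasure fun g => ?_
    rw [integral_weightedSnd hm hm0 π g.continuous.measurable, h g,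
      integral_eq_weightedSnd hm hm0, integral_smul_measure, smul_eq_mul]

/-- There is a plan of maximal transported mass. -/
lemma exists_isMaxOn_plans [CompactSpace X] (hmc : Continuous fun p : X × Y => m p.1 p.2)
    (hd : 0 < d) (hdm : ∀ x y, d ≤ m x y) (hm1 : ∀ x y, m x y ≤ 1) (μ : Measure X) (ν : Measure Y)
    [IsProbabilityMeasure μ] [IsProbabilityMeasure ν] :
    ∃ π ∈ plans m μ ν, ∀ ρ ∈ plans m μ ν, ∫ p, m p.1 p.2 ∂ρ ≤ ∫ p, m p.1 p.2 ∂π := by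
  let S : Set (ProbabilityMeasure (X × Y)) := {P | (P : Measure (X × Y)) ∈ plans m μ ν}
  have hmcont : Continuous fun P : ProbabilityMeasure (X × Y) => 
      ∫ p, m p.1 p.2 ∂(P : Measure (X × Y)) :=
    ProbabilityMeasure.continuous_integral_continuousMap
      (⟨fun p => m p.1 p.2, hmc⟩ : C(X × Y, ℝ))
  have hS : IsClosed S := by
    have hSeq : S =
        {P : ProbabilityMeasure (X × Y) |
          P.map continuous_fst.measurable.aemeasurable = ⟨μ, inferInstance⟩} ∩
        ⋂ g : BoundedContinuousFunction Y ℝ,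
          {P : ProbabilityMeasure (X × Y) | ∫ p, m p.1 p.2 * g p.2 ∂(P : Measure (X × Y)) =
            (∫ p, m p.1 p.2 ∂(P : Measure (X × Y))) * ∫ y, g y ∂ν} := by
      ext P
      simp only [S, Set.mem_ofPred_eq, mem_plans_iff_forall_integral hmc hd hdm hm1,
        Set.mem_inter_iff, Set.mem_iInter]
      refine and_congr_left fun _ => ?_
      exact ProbabilityMeasure.toMeasure_injective.eq_iff
        (a := P.map continuous_fst.measurable.aemeasurable)
        (b := (⟨μ, inferInstance⟩ : ProbabilityMeasure X))
    rw [hSeq]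
    refine (isClosed_singleton.preimage (ProbabilityMeasure.continuous_map continuous_fst)).inter
      (isClosed_iInter fun g => isClosed_eq ?_ (hmcont.mul continuous_const))
    exact ProbabilityMeasure.continuous_integral_continuousMap
      (⟨fun p => m p.1 p.2 * g p.2, hmc.mul (g.continuous.comp continuous_snd)⟩ : C(X × Y, ℝ))
  obtain ⟨π₀, hπ₀⟩ := plans_nonempty hmc hd hdm hm1 μ ν
  obtain ⟨P, hP, hmax⟩ := hS.isCompact.exists_isMaxOn ⟨⟨π₀, hπ₀.1⟩, hπ₀⟩ hmcont.continuousOn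
  exact ⟨P, hP, fun ρ hρ => hmax (show (⟨ρ, hρ.1⟩ : ProbabilityMeasure (X × Y)) ∈ S from hρ)⟩

/-- On probability measures `∫ c = (1 - ∫ m) / k`, so the cost can be dropped in favour of the
transported mass. -/
lemma isOptimalPlan_iff [CompactSpace X] {c : X → Y → ℝ} {k : ℝ} (hk : 0 < k)
    (hcm : ∀ x y, m x y = 1 - k * c x y)
    (hmc : Continuous fun p : X × Y => m p.1 p.2) {μ : Measure X} {ν : Measure Y}
    {π : Measure (X × Y)} :
    IsOptimalPlan c m μ ν π ↔ π ∈ plans m μ ν ∧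
      ∀ ρ ∈ plans m μ ν, ∫ p, m p.1 p.2 ∂ρ ≤ ∫ p, m p.1 p.2 ∂π := by
  have hc : ∀ ρ ∈ plans m μ ν, ∫ p, c p.1 p.2 ∂ρ = (1 - ∫ p, m p.1 p.2 ∂ρ) / k := by
    intro ρ hρ
    have := hρ.1
    have hint : Integrable (fun p : X × Y => m p.1 p.2) ρ :=
      hmc.integrable_of_hasCompactSupport (HasCompactSupport.of_compactSpace _)
    have : ∀ p : X × Y, c p.1 p.2 = (1 - m p.1 p.2) / k := fun p => by
      rw [hcm]; field_simp; ring
    simp_rw [this]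
    rw [integral_div, integral_sub (integrable_const _) hint]
    simp
  refine and_congr_right fun hπ => forall₂_congr fun ρ hρ => ?_
  rw [hc π hπ, hc ρ hρ, div_le_div_iff_of_pos_right hk, sub_le_sub_iff_left]

end Existence

/-- Weighting a plan carried by the graph of `S` gives `m (S y) y` times `lam`, which must be `M •
ν`. Dividing by the density recovers `lam`, and the normalizing constant is `M⁻¹`. -/
lemma dualSource_eq {X Y : Type*} [MeasurableSpace X] [MeasurableSpace Y] {m : X → Y → ℝ}
    (hm : Measurable fun p : X × Y => m p.1 p.2) (hm0 : ∀ x y, 0 < m x y) {ν : Measure Y}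
    [IsProbabilityMeasure ν] {lam : Measure Y} [IsProbabilityMeasure lam] {S : Y → X}
    (hS : Measurable S) {M : ℝ≥0∞} (hM0 : M ≠ 0) (hMt : M ≠ ∞)
    (hW : weightedSnd (weight m) (lam.map fun y => (S y, y)) = M • ν) :
    dualSource m ν S = lam := by
  have hSm : Measurable fun y => (S y, y) := hS.prodMk measurable_id
  set f : Y → ℝ≥0∞ := fun y => weight m (S y, y) with hf
  have hfm : Measurable f := (measurable_weight hm).comp hSm
  have h1 : lam.withDensity f = M • ν := by
    rw [← hW]
    ext B hB
    rw [weightedSnd_apply _ _ hB, withDensity_apply _ hB,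
      setLIntegral_map (measurable_snd hB) (measurable_weight hm) hSm]
    rfl
  have h2 : dualDensityMeasure m ν S = ν.withDensity fun y => (f y)⁻¹ := by
    rw [dualDensityMeasure]
    congr 1
    funext y
    rw [one_div, ENNReal.ofReal_inv_of_pos (hm0 _ _)]
    rfl
  have h3 : M • dualDensityMeasure m ν S = lam := by
    rw [h2, ← withDensity_smul_measure, ← h1]
    refine withDensity_inv_same hfm ?_ ?_
    · exact Filter.Eventually.of_forall fun y => by simpa [hf, weight] using hm0 _ _
    · exact Filter.Eventually.of_forall fun y => ENNReal.ofReal_ne_top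
  have h4 : dualDensityMeasure m ν S = M⁻¹ • lam := by
    rw [← h3, smul_smul, ENNReal.inv_mul_cancel hM0 hMt, one_smul]
  rw [dualSource, h4, Measure.smul_apply, measure_univ, smul_eq_mul, mul_one, inv_inv, smul_smul,
    ENNReal.mul_inv_cancel hM0 hMt, one_smul]

end NonConservativeOT

open NonConservativeOT

/-! ### The main theorem -/

theorem mainTheorem5 (n : ℕ) (X Y : Set (EuclideanSpace ℝ (Fin n)))
    (hX : NonConservativeOT.IsCompactDomain X) (hY : NonConservativeOT.IsCompactDomain Y)
    (k : ℝ) (hk : 0 < k)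
    (hm : 0 < ⨅ p : X × Y, NonConservativeOT.leakyFactor k (p.1 : EuclideanSpace ℝ (Fin n)) p.2)
    (μ : MeasureTheory.Measure X) (ν : MeasureTheory.Measure Y)
    (hμ : MeasureTheory.IsProbabilityMeasure μ) (hν : MeasureTheory.IsProbabilityMeasure ν)
    (c m : X → Y → ℝ)
    (hc : ∀ (x : X) (y : Y), c x y = NonConservativeOT.quadraticCost (n := n) x y)
    (hmass : ∀ (x : X) (y : Y), m x y = NonConservativeOT.leakyFactor (n := n) k x y) :
    -- an optimal transport plan exists
    (∃ π : MeasureTheory.Measure (X × Y), NonConservativeOT.IsOptimalPlan c m μ ν π) ∧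
    -- (i) optimal plans are given by primal optimal transport maps
    ((μ.map Subtype.val).AbsolutelyContinuous
        (MeasureTheory.volume : MeasureTheory.Measure (EuclideanSpace ℝ (Fin n))) →
      MeasureTheory.volume (frontier X) = 0 →
      ∀ π : MeasureTheory.Measure (X × Y), NonConservativeOT.IsOptimalPlan c m μ ν π →
        ∃ T : X → Y, NonConservativeOT.IsOptimalMap c m μ ν π T) ∧
    -- (ii) optimal plans are given by dual optimal transport maps
    ((ν.map Subtype.val).AbsolutelyContinuous
        (MeasureTheory.volume : MeasureTheory.Measure (EuclideanSpace ℝ (Fin n))) →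
      MeasureTheory.volume (frontier Y) = 0 →
      ∀ π : MeasureTheory.Measure (X × Y), NonConservativeOT.IsOptimalPlan c m μ ν π →
        ∃ S : Y → X, NonConservativeOT.IsDualOptimalMap c m μ ν π S) := by
  have := isCompact_iff_compactSpace.1 hX.isCompact
  have := isCompact_iff_compactSpace.1 hY.isCompact
  have hcm : ∀ x y, m x y = 1 - k * c x y := fun x y => by
    rw [hmass, hc, leakyFactor, quadraticCost]; ring
  have hmc : Continuous fun p : X × Y => m p.1 p.2 := by
    simp only [hmass, leakyFactor]
    fun_prop
  obtain ⟨d, hd, hdm⟩ : ∃ d : ℝ, 0 < d ∧ ∀ x y, d ≤ m x y := by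
    -- A real infimum of a family unbounded below is 0 by convention, which `hm` excludes.
    have hbdd : BddBelow (Set.range fun p : X × Y => leakyFactor (n := n) k p.1 p.2) := by
      by_contra h
      rw [Real.iInf_of_not_bddBelow h] at hm
      exact lt_irrefl 0 hm
    refine ⟨_, hm, fun x y => ?_⟩
    rw [hmass]
    exact ciInf_le hbdd (x, y)
  have hm1 : ∀ x y, m x y ≤ 1 := fun x y => by
    have : 0 ≤ k / 2 * ‖(x : EuclideanSpace ℝ (Fin n)) - y‖ ^ 2 := by positivity
    rw [hmass, leakyFactor]
    linarith
  have hm0 : ∀ x y, 0 < m x y := fun x y => hd.trans_le (hdm x y)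
  have hdl : ∀ (x : X) (y : Y), d ≤ leakyFactor (n := n) k x y := fun x y => hmass x y ▸ hdm x y
  have hdl' : ∀ (y : Y) (x : X), d ≤ leakyFactor (n := n) k y x := fun y x => by
    rw [leakyFactor_comm]; exact hdl x y
  obtain ⟨K, hK⟩ := exists_lipschitz_neg_log_leakyFactor hk hd hdl
  obtain ⟨K', hK'⟩ := exists_lipschitz_neg_log_leakyFactor hk hd hdl'
  have hpot : ∀ π : Measure (X × Y), IsOptimalPlan c m μ ν π →
      ∃ φ : X → ℝ, LipschitzWith K φ ∧ ∀ p ∈ π.support, ∀ x, φ x ≤ φ p.1 +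
        (-Real.log (m x p.2) - -Real.log (m p.1 p.2)) := by
    intro π hπ
    obtain ⟨hπ, hmax⟩ := (isOptimalPlan_iff hk hcm hmc).1 hπ
    have hπp := hπ.1
    refine (isCyclicallyMonotone_support hmc hmc.measurable hd hdm hm1 hπ fun ρ hρ => ?_
      ).exists_potential (Measure.nonempty_support (IsProbabilityMeasure.ne_zero π))
      (by simpa only [hmass] using hK)
    have hρp := hρ.1
    have hfin : ∀ ρ : Measure (X × Y), IsProbabilityMeasure ρ →
        weightedSnd (weight m) ρ Set.univ ≠ ∞ := fun ρ hρ =>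
      ne_top_of_le_ne_top ENNReal.one_ne_top (weightedSnd_univ_le_one (weight_le_one hm1) ρ)
    rw [← ENNReal.toReal_le_toReal (hfin ρ hρp) (hfin π hπp),
      ← integral_eq_weightedSnd hmc.measurable (fun x y => (hm0 x y).le),
      ← integral_eq_weightedSnd hmc.measurable (fun x y => (hm0 x y).le)]
    exact hmax ρ hρ
  refine ⟨?_, fun hac hfr π hπ => ?_, fun hac hfr π hπ => ?_⟩
  · obtain ⟨π, hπ⟩ := exists_isMaxOn_plans hmc hd hdm hm1 μ ν
    exact ⟨π, (isOptimalPlan_iff hk hcm hmc).2 hπ⟩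
  · obtain ⟨φ, hφK, hφ⟩ := hpot π hπ
    have hπμ : π.map Prod.fst = μ := hπ.1.2.1
    obtain ⟨T, hT, hTπ⟩ := exists_measurable_map_of_potential hX.isCompact
      hY.isCompact hY.nonempty hfr hk hd hdl (π := π) (by rwa [hπμ]) Measure.isClosed_support
      Measure.support_mem_ae hφK (by simpa only [hmass] using hφ)
    rw [hπμ] at hTπ
    exact ⟨T, hπ, hT, hTπ⟩
  · obtain ⟨φ, hφK, hφ⟩ := hpot π hπ
    obtain ⟨hπp, hπμ, M, hM⟩ := (mem_plans_iff hmc.measurable hd hdm hm1).1 hπ.1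
    have hMu : weightedSnd (weight m) π Set.univ = M := by rw [hM]; simp
    have hdw : ∀ p : X × Y, ENNReal.ofReal d ≤ weight m p :=
      fun p => ENNReal.ofReal_le_ofReal (hdm _ _)
    have hd0 : ENNReal.ofReal d ≠ 0 := by simpa using hd
    have hM0 : M ≠ 0 := hMu ▸ weightedSnd_univ_pos hd0 hdw π
    have hMt : M ≠ ∞ := hMu ▸
      ne_top_of_le_ne_top ENNReal.one_ne_top (weightedSnd_univ_le_one (weight_le_one hm1) π)
    -- The lower bound on `m` gives `d` times the second marginal at most `M • ν`, so absolute
    -- continuity passes from `ν` to the marginal that drives the dual map.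
    have hlamν : π.map Prod.snd ≪ ν := by
      have h1 : ENNReal.ofReal d • π.map Prod.snd ≤ M • ν :=
        hM ▸ le_weightedSnd_of_ae_le (Filter.Eventually.of_forall hdw)
      refine Measure.AbsolutelyContinuous.mk fun B _ hB => ?_
      have := h1 B
      simpa [hB, hd.not_ge] using this
    have hswap : (π.map Prod.swap).map Prod.fst = π.map Prod.snd :=
      Measure.map_map measurable_fst measurable_swap
    have hcyc := isCyclicallyMonotone_swap_of_potential
      (C := fun (x : X) (y : Y) => -Real.log (m x y)) hφ
    have hsupp : ∀ᵐ p ∂(π.map Prod.swap), p ∈ Prod.swap ⁻¹' π.support := by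
      refine (ae_map_iff measurable_swap.aemeasurable
        (Measure.isClosed_support.preimage continuous_swap).measurableSet).2 ?_
      filter_upwards [Measure.support_mem_ae (μ := π)] with p hp
      simpa using hp
    obtain ⟨⟨x₀, y₀⟩, hp₀⟩ := Measure.nonempty_support (IsProbabilityMeasure.ne_zero π)
    obtain ⟨ψ, hψK, hψ⟩ := hcyc.exists_potential ⟨(y₀, x₀), hp₀⟩ (K := K') (fun x => by
      simpa only [hmass, leakyFactor_comm (x : EuclideanSpace ℝ (Fin n))] using hK' x)
    obtain ⟨S, hS, hSπ⟩ := exists_measurable_map_of_potential hY.isCompact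
      hX.isCompact hX.nonempty hfr hk hd hdl'
      (π := π.map Prod.swap)
      (by rw [hswap]; exact (hlamν.map measurable_subtype_coe).trans hac)
      (Measure.isClosed_support.preimage continuous_swap) hsupp hψK
      (fun p hp y => by
        rw [leakyFactor_comm (y : EuclideanSpace ℝ (Fin n)),
          leakyFactor_comm (p.1 : EuclideanSpace ℝ (Fin n)), ← hmass, ← hmass]
        exact hψ p hp y)
    rw [hswap] at hSπ
    have hπS : π = (π.map Prod.snd).map fun y => (S y, y) := by
      have := congrArg (Measure.map Prod.swap) hSπ
      rw [Measure.map_map measurable_swap measurable_swap,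
        Measure.map_map measurable_swap
          (show Measurable fun y => (y, S y) from measurable_id.prodMk hS), Prod.swap_swap_eq,
        Measure.map_id] at this
      exact this
    have hlamp : IsProbabilityMeasure (π.map Prod.snd) :=
      Measure.isProbabilityMeasure_map measurable_snd.aemeasurable
    have hds := dualSource_eq hmc.measurable hm0 hS hM0 hMt (by rw [← hπS]; exact hM)
    exact ⟨S, hπ, hS, by rw [hds]; exact hlamp, by rw [hds]; exact hπS⟩
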